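/- Let $k$ be an algebraically closed field of characteristic $p>2$, and let $n\ge 1$. Let $G$ be either $\mathrm{Sp}_n(k)$ (with $n$ even) or $\mathrm{O}_n(k)$, with Lie algebra $\mathfrak g=\mathfrak{sp}_n(k)$, respectively $\mathfrak{so}_n(k)$, on which $G$ acts by conjugation. Let $\mathcal N$ be the set of nilpotent matrices in $\mathfrak g$ and let $$\mathcal N^{p-1}:=\{x\in\mathcal N \mid x^{p-1}=0\}.$$ An $\mathfrak{sl}_2$-triple in $\mathfrak g$ is a triple $(e,h,f)$ of elements of $\mathfrak g$ with $[h,e]=2e$, $[h,f]=-2f$ and $[e,f]=h$ (the zero triple is allowed); $G$ acts on such triples by simultaneous conjugation. Then $\mathcal N^{p-1}$ satisfies the $\mathfrak{sl}_2$-property: it is a $G$-stable Zariski closed subset of $\mathcal N$, and the map $$\{\,G\text{-orbits of }\mathfrak{sl}_2\text{-triples }(e,h,f)\text{ in }\mathfrak g\text{ with } e,f\in\mathcal N^{p-1}\}\longrightarrow\{\,G\text{-orbits in }\mathcal N^{p-1}\}$$ sending the $G$-orbit of $(e,h,f)$ to the $G$-orbit of $e$ is a bijection. -/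

import Mathlib

attribute [local instance] LieRing.ofAssociativeRing

namespace Sl2Property

variable {k ι : Type*} [Field k] [Fintype ι] [DecidableEq ι]

/-- The adjoint action of an invertible matrix: `x ↦ g x g⁻¹`. -/
def Ad (g : GL ι k) (x : Matrix ι ι k) : Matrix ι ι k :=
  g.1 * x * (g⁻¹).1

theorem Ad_one (x : Matrix ι ι k) : Ad 1 x = x := by
  simp [Ad]

theorem Ad_mul (a b : GL ι k) (x : Matrix ι ι k) : Ad (a * b) x = Ad a (Ad b x) := by
  simp [Ad, mul_assoc]

theorem Ad_inv_of_eq {g : GL ι k} {x y : Matrix ι ι k} (h : Ad g x = y) : Ad g⁻¹ y = x := by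
  rw [← h, ← Ad_mul, inv_mul_cancel, Ad_one]

/-- The nilpotent cone of a Lie algebra `𝔤` of matrices: the nilpotent matrices lying in `𝔤`. -/
def nilCone (𝔤 : LieSubalgebra k (Matrix ι ι k)) : Set (Matrix ι ι k) :=
  {x | x ∈ 𝔤 ∧ IsNilpotent x}

/-- `𝒩^r = {x ∈ 𝒩 | x ^ r = 0}`. -/
def nilConePow (𝔤 : LieSubalgebra k (Matrix ι ι k)) (r : ℕ) : Set (Matrix ι ι k) :=
  {x | x ∈ nilCone 𝔤 ∧ x ^ r = 0}

/-- Zariski closed sets of matrices: common zero sets of polynomials in the matrix entries. -/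
def IsZariskiClosed (V : Set (Matrix ι ι k)) : Prop :=
  ∃ S : Set (MvPolynomial (ι × ι) k),
    V = {x | ∀ q ∈ S, MvPolynomial.eval (fun ij : ι × ι => x ij.1 ij.2) q = 0}

/-- Stability of a set of matrices under the adjoint action of `G`. -/
def IsStable (G : Subgroup (GL ι k)) (V : Set (Matrix ι ι k)) : Prop :=
  ∀ g ∈ G, ∀ x ∈ V, Ad g x ∈ V

/-- `(e, h, f)` is an `sl₂`-triple: `[h,e] = 2e`, `[h,f] = -2f`, `[e,f] = h`.
Unlike in Mathlib's `IsSl2Triple`, the zero triple is allowed. -/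
structure IsTriple {L : Type*} [LieRing L] (e h f : L) : Prop where
  lie_h_e : ⁅h, e⁆ = 2 • e
  lie_h_f : ⁅h, f⁆ = -(2 • f)
  lie_e_f : ⁅e, f⁆ = h

/-- The `sl₂`-triples `(e, h, f)` in `𝔤` with `e, f ∈ V`. -/
structure Triple (𝔤 : LieSubalgebra k (Matrix ι ι k)) (V : Set (Matrix ι ι k)) where
  e : Matrix ι ι k
  h : Matrix ι ι k
  f : Matrix ι ι k
  e_mem : e ∈ 𝔤
  h_mem : h ∈ 𝔤
  f_mem : f ∈ 𝔤
  isTriple : IsTriple e h f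
  e_mem_V : e ∈ V
  f_mem_V : f ∈ V

/-- Two elements of `V` are equivalent when they lie in the same `G`-orbit. -/
def elementSetoid (G : Subgroup (GL ι k)) (V : Set (Matrix ι ι k)) : Setoid V where
  r x y := ∃ g ∈ G, Ad g x.1 = y.1
  iseqv :=
    { refl := fun x => ⟨1, G.one_mem, Ad_one x.1⟩
      symm := fun ⟨g, hg, h⟩ => ⟨g⁻¹, G.inv_mem hg, Ad_inv_of_eq h⟩
      trans := fun ⟨a, ha, h⟩ ⟨b, hb, h'⟩ =>
        ⟨b * a, G.mul_mem hb ha, by rw [Ad_mul, h, h']⟩ }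

/-- Two triples are equivalent when they lie in the same orbit of `G`, which acts simultaneously
on the three entries. -/
def tripleSetoid (G : Subgroup (GL ι k)) (𝔤 : LieSubalgebra k (Matrix ι ι k))
    (V : Set (Matrix ι ι k)) : Setoid (Triple 𝔤 V) where
  r s t := ∃ g ∈ G, Ad g s.e = t.e ∧ Ad g s.h = t.h ∧ Ad g s.f = t.f
  iseqv :=
    { refl := fun s => ⟨1, G.one_mem, Ad_one s.e, Ad_one s.h, Ad_one s.f⟩
      symm := fun ⟨g, hg, h₁, h₂, h₃⟩ =>
        ⟨g⁻¹, G.inv_mem hg, Ad_inv_of_eq h₁, Ad_inv_of_eq h₂, Ad_inv_of_eq h₃⟩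
      trans := fun ⟨a, ha, h₁, h₂, h₃⟩ ⟨b, hb, h₁', h₂', h₃'⟩ =>
        ⟨b * a, G.mul_mem hb ha, by rw [Ad_mul, h₁, h₁'], by rw [Ad_mul, h₂, h₂'],
          by rw [Ad_mul, h₃, h₃']⟩ }

/-- The map from `G`-orbits of `sl₂`-triples `(e, h, f)` in `𝔤` with `e, f ∈ V` to `G`-orbits
in `V`, sending the orbit of `(e, h, f)` to the orbit of `e`. -/
def orbitMap (G : Subgroup (GL ι k)) (𝔤 : LieSubalgebra k (Matrix ι ι k))
    (V : Set (Matrix ι ι k)) :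
    Quotient (tripleSetoid G 𝔤 V) → Quotient (elementSetoid G V) :=
  Quotient.map' (fun t => ⟨t.e, t.e_mem_V⟩) (fun _ _ ⟨g, hg, h, _⟩ => ⟨g, hg, h⟩)

/-- `V` is a `G`-stable closed subvariety of the nilpotent cone of `𝔤` that satisfies the
`sl₂`-property (here `𝔤` stands for the Lie algebra of `G`). -/
structure HasSl2Property (G : Subgroup (GL ι k)) (𝔤 : LieSubalgebra k (Matrix ι ι k))
    (V : Set (Matrix ι ι k)) : Prop where
  subset_nilCone : V ⊆ nilCone 𝔤
  isZariskiClosed : IsZariskiClosed V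
  isStable : IsStable G V
  bijective_orbitMap : Function.Bijective (orbitMap G 𝔤 V)

/-- `O_n(k)`, for the symmetric form with Gram matrix `1`, as a subgroup of `GL_n(k)`. -/
def orthogonalGL (k : Type*) [Field k] (n : ℕ) : Subgroup (GL (Fin n) k) :=
  (Matrix.orthogonalGroup (Fin n) k).units

/-- `Sp_{2m}(k)`, for the alternating form with Gram matrix `Matrix.J`, as a subgroup of
`GL_{2m}(k)`. -/
def symplecticGL (k : Type*) [Field k] (m : ℕ) : Subgroup (GL (Fin m ⊕ Fin m) k) :=
  (Matrix.symplecticGroup (Fin m) k).units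

end Sl2Property

/-!
The idea is that everything about orbits can be done in `GL_n` first, and that passing from `GL_n`
to the isometry group of a form is a matter of taking square roots.

*Uniqueness in `GL_n`.* Let `(e, h, f)` be an `sl₂`-triple of endomorphisms of `V` with
`e ^ (p - 1) = f ^ (p - 1) = 0`. On `ker (e f)`, which contains `ker f`, the operator `fʲ eʲ` is up
to a nonzero factor the polynomial `h (h + 1) ⋯ (h + j - 1)` (`IsTriple.f_pow_e_pow`), and for
`j = p - 1` it vanishes. So `h` is diagonalizable there, with eigenvalues `-d`, `0 ≤ d ≤ p - 2`. This
gives `ker f ∩ e V = 0` and, exchanging `e` and `f`, `V = ker f ⊕ e V`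
(`IsTriple.ker_f_sup_range_e`). Hence the vectors `eⁱ v`, for `v` in an eigenbasis of `ker f`, form a
Jordan basis for `e` in which `h` and `f` are given by the standard formulas
(`IsTriple.exists_isChainBasis`). As the block sizes are determined by the ranks of the powers of
`e`, so is the triple up to isomorphism (`IsTriple.exists_linearEquiv`).

*Square roots.* If `B` and `C` are nondegenerate forms, both symmetric or both alternating, then
`B⁻¹ C` has a square root `r` that is a polynomial in it, and `rᵀ B r = C`; moreover `r` commutes with
all matrices that are skew for both `B` and `C` (`exists_transpose_mul_mul_eq`).

*Injectivity.* If `g ∈ GL_n` conjugates one triple of skew matrices into another, then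
the first triple is skew for both `B` and `gᵀ B g`, and `g r⁻¹` is an isometry of `B` that conjugates
the two triples (`exists_isometry_of_conj`).

*Surjectivity.* Let `e` be skew for `B`, and take a Jordan basis of `e`. It defines a standard triple
`(e, h, f)` and a grading of `V` by integral weights. The component of degree zero of `B` is a form
for which the whole triple is skew, and it is nondegenerate because `B` has no component of positive
degree (`IsChainBasis.exists_form`). An `r` as above carries this form to `B`, commutes with `e`, and
conjugates `f` to a matrix that is skew for `B` (`exists_isTriple_of_skew`).
-/

/-! ### Lowest weight vectors of `sl₂`-triples -/

namespace Sl2Property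

open Module Polynomial

section Triple

variable {k V : Type*} [Field k] [AddCommGroup V] [Module k V] {e h f : End k V}

theorem aeval_apply_eq_eval_smul {h : End k V} {v : V} {a : k} (hv : h v = a • v)
    (q : k[X]) : aeval h q v = q.eval a • v := by
  by_cases h0 : v = 0
  · simp [h0]
  · exact Module.End.aeval_apply_of_hasEigenvector ⟨Module.End.mem_eigenspace_iff.2 hv, h0⟩

theorem ascPochhammer_eval_neg_self (d : ℕ) :
    (ascPochhammer k d).eval (-(d : k)) = (-1) ^ d * d.factorial := by
  rw [ascPochhammer_eval_neg_eq_descPochhammer, descPochhammer_eval_eq_descFactorial,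
    Nat.descFactorial_self]

namespace IsTriple

theorem swap (t : IsTriple e h f) : IsTriple f (-h) e := by
  refine ⟨?_, ?_, ?_⟩
  · rw [neg_lie, t.lie_h_f, neg_neg]
  · rw [neg_lie, t.lie_h_e]
  · rw [← lie_skew, t.lie_e_f]

theorem h_e (t : IsTriple e h f) (v : V) : h (e v) = e (h v) + (2 : k) • e v := by
  have := LinearMap.congr_fun t.lie_h_e v
  rw [LieRing.of_associative_ring_bracket] at this
  simp only [LinearMap.sub_apply, Module.End.mul_apply, LinearMap.smul_apply] at this
  rw [sub_eq_iff_eq_add'] at this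
  rw [this, two_smul, two_smul]

theorem e_f (t : IsTriple e h f) (v : V) : e (f v) = f (e v) + h v := by
  have := LinearMap.congr_fun t.lie_e_f v
  rw [LieRing.of_associative_ring_bracket] at this
  simp only [LinearMap.sub_apply, Module.End.mul_apply] at this
  rw [← this]; abel

theorem h_f (t : IsTriple e h f) (v : V) : h (f v) = f (h v) - (2 : k) • f v := by
  have := t.swap.h_e v
  simp only [LinearMap.neg_apply, map_neg] at this
  rw [neg_eq_iff_eq_neg] at this
  rw [this]; abel

theorem h_e_pow (t : IsTriple e h f) (j : ℕ) (v : V) :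
    h ((e ^ j) v) = (e ^ j) (h v) + (2 * j : k) • (e ^ j) v := by
  induction j with
  | zero => simp
  | succ j ih =>
    rw [pow_succ', Module.End.mul_apply, t.h_e, ih, Module.End.mul_apply]
    simp only [map_add, map_smul, Nat.cast_add, Nat.cast_one]
    module

theorem f_e_pow_succ (t : IsTriple e h f) (j : ℕ) (v : V) :
    f ((e ^ (j + 1)) v) = (e ^ (j + 1)) (f v) - (j + 1 : k) • (e ^ j) (h v + (j : k) • v) := by
  induction j with
  | zero =>
    have := t.e_f v
    simp [this]
  | succ j ih =>
    have h1 := t.e_f ((e ^ (j + 1)) v)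
    rw [ih, t.h_e_pow] at h1
    have h2 : (e ^ (j + 1 + 1)) v = e ((e ^ (j + 1)) v) := by
      rw [pow_succ', Module.End.mul_apply]
    rw [h2, eq_sub_of_add_eq h1.symm]
    simp only [map_sub, map_add, map_smul, pow_succ' e, Module.End.mul_apply, Nat.cast_add,
      Nat.cast_one]
    module

theorem f_e_pow_succ_of_lowest (t : IsTriple e h f) {v : V} (hf : f v = 0) {d : k}
    (hv : h v = -d • v) (j : ℕ) :
    f ((e ^ (j + 1)) v) = ((j + 1) * (d - j) : k) • (e ^ j) v := by
  rw [t.f_e_pow_succ, hf, hv]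
  simp only [map_zero, map_add, map_smul]
  module

/-- On `ker (e f)`, which `h` preserves, the operator `fʲ eʲ` is a polynomial in `h` whose roots are
`0, -1, …, -(j - 1)`. -/
theorem f_pow_e_pow (t : IsTriple e h f) (j : ℕ) {v : V} (hv : e (f v) = 0) :
    (f ^ j) ((e ^ j) v) = ((-1) ^ j * j.factorial : k) • aeval h (ascPochhammer k j) v := by
  induction j generalizing v with
  | zero => simp
  | succ j ih =>
    have hv' : e (f (h v)) = 0 := by
      have h1 := t.h_e (f v)
      rw [t.h_f, hv] at h1
      simpa [hv] using h1.symm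
    have h2 : (e ^ (j + 1)) (f v) = 0 := by rw [pow_succ, Module.End.mul_apply, hv, map_zero]
    rw [pow_succ f, Module.End.mul_apply, t.f_e_pow_succ, h2, zero_sub, map_neg, map_smul,
      ih (v := h v + (j : k) • v) (by simp [hv, hv']), ascPochhammer_succ_right, map_mul,
      Module.End.mul_apply, map_add (aeval h), aeval_X, map_natCast, LinearMap.add_apply,
      Module.End.natCast_apply, ← Nat.cast_smul_eq_nsmul k, Nat.factorial_succ]
    push_cast
    module

/-- The weight `-d` is the one for which `fᵈ eᵈ` returns a lowest weight vector to a multiple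
of itself by `(d!)²`. -/
theorem f_pow_e_pow_of_weight (t : IsTriple e h f) (d : ℕ) {v : V} (hv : e (f v) = 0)
    (hh : h v = -(d : k) • v) :
    (f ^ d) ((e ^ d) v) = (d.factorial ^ 2 : k) • v := by
  rw [t.f_pow_e_pow d hv, aeval_apply_eq_eval_smul hh, ascPochhammer_eval_neg_self, smul_smul]
  congr 1
  have : ((-1 : k) ^ d) * (-1) ^ d = 1 := by rw [← mul_pow]; simp
  linear_combination (d.factorial : k) ^ 2 * this

end IsTriple

end Triple

section CharP

variable {k V : Type*} [Field k] [AddCommGroup V] [Module k V] {e h f : End k V}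
  (p : ℕ) [CharP k p] [Fact p.Prime]

theorem factorial_cast_ne_zero {d : ℕ} (hd : d < p) : (d.factorial : k) ≠ 0 := by
  rw [Ne, CharP.cast_eq_zero_iff k p, (Fact.out : p.Prime).dvd_factorial]
  omega

/-- A vector killed by `h (h + 1) ⋯ (h + j - 1)` is a sum of eigenvectors, because these factors
are distinct. -/
theorem mem_span_eigenvectors (P : Submodule k V) (hP : ∀ v ∈ P, h v ∈ P) {j : ℕ} (hj : j < p)
    {v : V} (hv : v ∈ P) (h0 : aeval h (ascPochhammer k j) v = 0) :
    v ∈ Submodule.span k {w | w ∈ P ∧ ∃ d < j, h w = -((d : ℕ) : k) • w} := by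
  induction j generalizing v with
  | zero =>
    have : v = 0 := by simpa using h0
    rw [this]; exact zero_mem _
  | succ j ih =>
    set z := aeval h (ascPochhammer k j) v with hz
    have hzP : z ∈ P := by
      have : ∀ q : k[X], aeval h q v ∈ P := by
        intro q
        induction q using Polynomial.induction_on' with
        | add a b ha hb => simpa using P.add_mem ha hb
        | monomial m a =>
          rw [aeval_monomial, Module.End.mul_apply, Module.algebraMap_end_apply]
          refine P.smul_mem _ ?_
          induction m with
          | zero => simpa
          | succ m ihm => rw [pow_succ', Module.End.mul_apply]; exact hP _ ihm
      exact this _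
    have hhz : h z = -(j : k) • z := by
      rw [ascPochhammer_succ_right, mul_comm, map_mul, Module.End.mul_apply, map_add, aeval_X,
        map_natCast, LinearMap.add_apply, Module.End.natCast_apply, ← hz] at h0
      rw [neg_smul, Nat.cast_smul_eq_nsmul]
      exact eq_neg_of_add_eq_zero_left h0
    set c : k := (-1) ^ j * j.factorial
    have hc : c ≠ 0 := mul_ne_zero (by simp) (factorial_cast_ne_zero p (by omega))
    have hz' : aeval h (ascPochhammer k j) z = c • z := by
      rw [aeval_apply_eq_eval_smul hhz, ascPochhammer_eval_neg_self]
    have h1 := ih (by omega) (v := v - c⁻¹ • z) (P.sub_mem hv (P.smul_mem _ hzP)) (by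
      rw [map_sub, map_smul, hz', smul_smul, inv_mul_cancel₀ hc, one_smul, ← hz, sub_self])
    have h2 : v = (v - c⁻¹ • z) + c⁻¹ • z := by abel
    rw [h2]
    refine Submodule.add_mem _ (Submodule.span_mono ?_ h1)
      (Submodule.smul_mem _ _ (Submodule.subset_span ⟨hzP, j, by omega, hhz⟩))
    rintro w ⟨hw, d, hd, hdw⟩
    exact ⟨hw, d, by omega, hdw⟩

namespace IsTriple

/-- A lowest weight vector of weight `-d` generates a module of dimension at most `d + 1`: otherwise
`e ^ (d + 1)` would send it to a lowest weight vector of weight `-(p - 2 - d)`, which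
`e ^ (p - 2 - d)` does not kill. -/
theorem e_pow_of_lowest (t : IsTriple e h f) (he : e ^ (p - 1) = 0) {d : ℕ} (hd : d < p - 1) {v : V}
    (hf : f v = 0) (hv : h v = -(d : k) • v) : (e ^ (d + 1)) v = 0 := by
  set u := (e ^ (d + 1)) v with hu
  obtain ⟨j, hj⟩ : ∃ j, p = j + d + 2 := ⟨p - 2 - d, by omega⟩
  have hp : (j + d + 2 : k) = 0 := by
    have := CharP.cast_eq_zero k p
    rw [hj] at this; exact_mod_cast this
  have hfu : f u = 0 := by rw [hu, t.f_e_pow_succ_of_lowest hf hv]; simp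
  have hhu : h u = -(j : k) • u := by
    rw [hu, t.h_e_pow, hv, map_smul, ← add_smul]
    congr 1
    push_cast
    linear_combination hp
  have h1 := t.f_pow_e_pow_of_weight j (by rw [hfu, map_zero]) hhu
  have h2 : (e ^ j) u = 0 := by
    rw [hu, ← Module.End.mul_apply, ← pow_add, show j + (d + 1) = p - 1 by omega, he,
      LinearMap.zero_apply]
  rw [h2, map_zero, eq_comm, smul_eq_zero] at h1
  exact h1.resolve_left (pow_ne_zero _ (factorial_cast_ne_zero p (by omega)))

/-- `ker f ∩ e V = 0`. For `x ∈ ker (f e)` of weight `N`, the vector `e x ∈ ker f` has weight `-d` with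
`N + d = p - 2`. As `e ^ N f ^ N` is invertible on `x`, the relation `e ^ (p - 1) = 0` gives
`e ^ d (e x) = 0`, and `f ^ d e ^ d` is invertible on `e x`. -/
theorem e_eq_zero_of_f_e (t : IsTriple e h f) (he : e ^ (p - 1) = 0) (hf : f ^ (p - 1) = 0) {x : V}
    (hx : f (e x) = 0) : e x = 0 := by
  have hp := (Fact.out : p.Prime).two_le
  let P : Submodule k V := LinearMap.ker (f * e)
  have hP : ∀ v ∈ P, (-h) v ∈ P := by
    intro v hv
    have hv : f (e v) = 0 := hv
    have h1 := t.h_f (e v)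
    rw [t.h_e, hv] at h1
    change f (e (-(h v))) = 0
    rw [map_neg, map_neg, neg_eq_zero]
    simpa [hv] using h1.symm
  have h0 := t.swap.f_pow_e_pow (p - 1) hx
  rw [hf, LinearMap.zero_apply, map_zero, eq_comm, smul_eq_zero] at h0
  have h0 := h0.resolve_left
    (mul_ne_zero (by simp) (factorial_cast_ne_zero p (by omega)))
  have hmem := mem_span_eigenvectors p P hP (by omega) hx h0
  suffices hle : Submodule.span k {w | w ∈ P ∧ ∃ d < p - 1, (-h) w = -((d : ℕ) : k) • w} ≤
    LinearMap.ker e from hle hmem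
  rw [Submodule.span_le]
  rintro w ⟨hw, N, hN, hhw⟩
  have hw : f (e w) = 0 := hw
  change e w = 0
  obtain ⟨d, hd⟩ : ∃ d, p = N + d + 2 := ⟨p - 2 - N, by omega⟩
  have hpz : (N + d + 2 : k) = 0 := by
    have := CharP.cast_eq_zero k p
    rw [hd] at this; exact_mod_cast this
  have h1 := congrArg (e ^ (d + 1)) (t.swap.f_pow_e_pow_of_weight N hw hhw)
  rw [← Module.End.mul_apply, ← pow_add, show d + 1 + N = p - 1 by omega, he,
    LinearMap.zero_apply, map_smul, eq_comm, smul_eq_zero] at h1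
  have h2 := h1.resolve_left (pow_ne_zero _ (factorial_cast_ne_zero p (by omega)))
  rw [pow_succ, Module.End.mul_apply] at h2
  have hhe : h (e w) = -(d : k) • e w := by
    rw [LinearMap.neg_apply, neg_smul, neg_inj] at hhw
    rw [t.h_e, hhw, map_smul, ← add_smul]
    congr 1
    linear_combination hpz
  have h3 := t.f_pow_e_pow_of_weight d (by rw [hw, map_zero]) hhe
  rw [h2, map_zero, eq_comm, smul_eq_zero] at h3
  exact h3.resolve_left (pow_ne_zero _ (factorial_cast_ne_zero p (by omega)))

variable [FiniteDimensional k V]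

/-- Complete reducibility, in the form in which it is needed: the lowest weight vectors generate. -/
theorem ker_f_sup_range_e (t : IsTriple e h f) (he : e ^ (p - 1) = 0) (hf : f ^ (p - 1) = 0) :
    LinearMap.ker f ⊔ LinearMap.range e = ⊤ := by
  have key : ∀ {e h f : End k V}, IsTriple e h f → e ^ (p - 1) = 0 → f ^ (p - 1) = 0 →
      finrank k (LinearMap.ker f) + finrank k (LinearMap.range e) =
        finrank k ↥(LinearMap.ker f ⊔ LinearMap.range e) := by
    intro e h f t he hf
    have : LinearMap.ker f ⊓ LinearMap.range e = ⊥ := by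
      rw [eq_bot_iff]
      rintro _ ⟨hv, x, rfl⟩
      exact t.e_eq_zero_of_f_e p he hf hv
    rw [← Submodule.finrank_sup_add_finrank_inf_eq, this, finrank_bot, add_zero]
  have h1 := key t he hf
  have h2 := key t.swap hf he
  have h3 := LinearMap.finrank_range_add_finrank_ker e
  have h4 := LinearMap.finrank_range_add_finrank_ker f
  have h5 := Submodule.finrank_le (LinearMap.ker e ⊔ LinearMap.range f)
  apply Submodule.eq_top_of_finrank_eq
  have h6 := Submodule.finrank_le (LinearMap.ker f ⊔ LinearMap.range e)
  omega

end IsTriple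

end CharP

end Sl2Property

/-! ### Jordan bases, and uniqueness of triples up to isomorphism -/

namespace Sl2Property

open Module Polynomial

section ChainBasis

variable {k V S : Type*} [Field k] [AddCommGroup V] [Module k V]

/-- A basis of Jordan type for `e`: it consists of the chains `v s, e (v s), …, e ^ (n s - 1) (v s)`,
each of which ends with `e ^ (n s) (v s) = 0`. Empty chains (`n s = 0`) are allowed. -/
structure IsChainBasis (e : End k V) (n : S → ℕ) (v : S → V)
    (b : Basis (Σ s, Fin (n s)) k V) : Prop where
  apply_eq : ∀ x, b x = (e ^ (x.2 : ℕ)) (v x.1)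
  pow_eq_zero : ∀ s, (e ^ n s) (v s) = 0

namespace IsChainBasis

variable {e : End k V} {n : S → ℕ} {v : S → V} {b : Basis (Σ s, Fin (n s)) k V}

theorem pow_apply_eq_zero (hb : IsChainBasis e n v b) {s : S} {i : ℕ} (hi : n s ≤ i) :
    (e ^ i) (v s) = 0 := by
  rw [← Nat.sub_add_cancel hi, pow_add, Module.End.mul_apply, hb.pow_eq_zero, map_zero]

theorem length_le (hb : IsChainBasis e n v b) {r : ℕ} (hr : e ^ r = 0) (s : S) : n s ≤ r := by
  by_contra! h
  apply b.ne_zero ⟨s, r, h⟩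
  rw [hb.apply_eq, hr, LinearMap.zero_apply]

theorem finrank_range_pow [Fintype S] (hb : IsChainBasis e n v b) (i : ℕ) :
    finrank k (LinearMap.range (e ^ i)) = ∑ s, (n s - i) := by
  let φ : (Σ s, Fin (n s - i)) → Σ s, Fin (n s) := fun x => ⟨x.1, i + x.2, by omega⟩
  have hφ : Function.Injective φ := by
    rintro ⟨s, j⟩ ⟨s', j'⟩ hh
    obtain rfl : s = s' := congrArg Sigma.fst hh
    simpa [φ, Fin.ext_iff] using hh
  have hspan : LinearMap.range (e ^ i) = Submodule.span k (Set.range (b ∘ φ)) := by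
    rw [LinearMap.range_eq_map, ← b.span_eq, Submodule.map_span, ← Set.range_comp]
    apply le_antisymm
    · rw [Submodule.span_le]
      rintro _ ⟨⟨s, j⟩, rfl⟩
      simp only [Function.comp, hb.apply_eq]
      rw [← Module.End.mul_apply, ← pow_add]
      by_cases hj : i + j < n s
      · exact Submodule.subset_span ⟨⟨s, j, by omega⟩, by simp [φ, hb.apply_eq]⟩
      · rw [hb.pow_apply_eq_zero (by omega)]
        exact zero_mem _
    · refine Submodule.span_mono ?_
      rintro _ ⟨⟨s, j⟩, rfl⟩
      refine ⟨⟨s, j, by omega⟩, ?_⟩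
      simp only [Function.comp, hb.apply_eq, φ]
      rw [← Module.End.mul_apply, ← pow_add]
  rw [hspan, finrank_span_eq_card (b.linearIndependent.comp φ hφ)]
  simp

/-- The number of chains of a given length is a second difference of the ranks of the powers
of `e`. -/
theorem card_length_eq [Fintype S] (hb : IsChainBasis e n v b) (i : ℕ) :
    (Fintype.card {s // n s = i + 1} : ℤ) = finrank k (LinearMap.range (e ^ i)) -
      2 * finrank k (LinearMap.range (e ^ (i + 1))) +
      finrank k (LinearMap.range (e ^ (i + 2))) := by
  rw [hb.finrank_range_pow, hb.finrank_range_pow, hb.finrank_range_pow, Fintype.card_subtype,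
    Finset.card_filter]
  push_cast
  rw [Finset.mul_sum, ← Finset.sum_sub_distrib, ← Finset.sum_add_distrib]
  refine Finset.sum_congr rfl fun s _ => ?_
  split_ifs <;> omega

end IsChainBasis

end ChainBasis

section Uniqueness

universe u
variable {k : Type*} {V V' : Type u} [Field k] [AddCommGroup V] [Module k V]
  [FiniteDimensional k V] [AddCommGroup V'] [Module k V'] [FiniteDimensional k V']
  (p : ℕ) [CharP k p] [Fact p.Prime]

theorem ascPochhammer_eval_neg_ne_zero {d i : ℕ} (hd : d < p) (hi : i ≤ d) :
    (ascPochhammer k i).eval (-(d : k)) ≠ 0 := by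
  rw [ascPochhammer_eval_neg_eq_descPochhammer, descPochhammer_eval_eq_descFactorial]
  refine mul_ne_zero (by simp) fun h0 => factorial_cast_ne_zero (k := k) p hd ?_
  rw [← Nat.factorial_mul_descFactorial hi, Nat.cast_mul, h0, mul_zero]

/-- If `e ^ (p - 1) = f ^ (p - 1) = 0`, then `V` is a direct sum of the standard simple modules
of dimension at most `p - 1`: the `v s` are their lowest weight vectors. -/
theorem IsTriple.exists_isChainBasis {e h f : End k V} (t : IsTriple e h f)
    (he : e ^ (p - 1) = 0) (hf : f ^ (p - 1) = 0) :
    ∃ (S : Type u) (_ : Fintype S) (n : S → ℕ) (v : S → V) (b : Basis (Σ s, Fin (n s)) k V),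
      IsChainBasis e n v b ∧ ∀ s, 0 < n s ∧ f (v s) = 0 ∧ h (v s) = -(n s - 1 : k) • v s := by
  have hp := (Fact.out : p.Prime).two_le
  let K := LinearMap.ker f
  set X : Set V := {w | w ∈ K ∧ ∃ d < p - 1, h w = -((d : ℕ) : k) • w} with hX
  have hspanX : Submodule.span k X = K := by
    apply le_antisymm
    · rw [Submodule.span_le]
      exact fun w hw => hw.1
    · intro w hw
      have hw0 : f w = 0 := hw
      refine mem_span_eigenvectors p K ?_ (by omega) hw ?_
      · intro x hx
        have hx : f x = 0 := hx
        change f (h x) = 0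
        simpa [hx] using (t.h_f x).symm
      · have h0 := t.f_pow_e_pow (p - 1) (v := w) (by rw [hw0, map_zero])
        rw [hf, LinearMap.zero_apply, eq_comm, smul_eq_zero] at h0
        exact h0.resolve_left
          (mul_ne_zero (by simp) (factorial_cast_ne_zero p (by omega)))
  obtain ⟨S, hSX, hspan, hli⟩ := exists_linearIndependent k X
  have : Fintype S := hli.setFinite.fintype
  choose hfS d hd hhS using fun s : S => hSX s.2
  replace hfS : ∀ s : S, f s = 0 := hfS
  have hefS : ∀ s : S, e (f s) = 0 := fun s => by rw [hfS, map_zero]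
  let n : S → ℕ := fun s => d s + 1
  have hn : ∀ s : S, (e ^ n s) (s : V) = 0 := fun s => t.e_pow_of_lowest p he (hd s) (hfS s) (hhS s)
  let w : (Σ s, Fin (n s)) → V := fun x => (e ^ (x.2 : ℕ)) (x.1 : V)
  -- Among the nonzero coefficients of a relation pick one with `i` maximal; `f ^ i` turns the
  -- relation into one between the lowest weight vectors.
  have hwli : LinearIndependent k w := by
    rw [Fintype.linearIndependent_iff]
    intro g hg
    classical
    by_contra! hne
    obtain ⟨x₀, hx₀⟩ := hne
    obtain ⟨⟨s₁, i₁⟩, hx₁, hmax⟩ := Finset.exists_max_image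
      (Finset.univ.filter fun x => g x ≠ 0) (fun x => (x.2 : ℕ)) ⟨x₀, by simpa using hx₀⟩
    simp only [Finset.mem_filter, Finset.mem_univ, true_and] at hx₁ hmax
    set i : ℕ := (i₁ : ℕ)
    let c : S → k := fun s =>
      ((-1) ^ i * i.factorial : k) * (ascPochhammer k i).eval (-(d s : k))
    have hfi : ∀ s : S, (f ^ i) ((e ^ i) (s : V)) = c s • (s : V) := fun s => by
      rw [t.f_pow_e_pow i (hefS s), aeval_apply_eq_eval_smul (hhS s), smul_smul]
    have hlow : ∀ (s : S) (j : ℕ), j < i → (f ^ i) ((e ^ j) (s : V)) = 0 := by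
      intro s j hj
      obtain ⟨m, hm⟩ := Nat.exists_eq_add_of_lt hj
      rw [show i = m + 1 + j by omega, pow_add, Module.End.mul_apply,
        t.f_pow_e_pow j (hefS s), aeval_apply_eq_eval_smul (hhS s), map_smul, map_smul, pow_succ,
        Module.End.mul_apply, hfS, map_zero, smul_zero, smul_zero]
    have h1 := congrArg (f ^ i) hg
    rw [map_sum, map_zero, Fintype.sum_sigma] at h1
    have h2 : ∀ s : S, ∑ j : Fin (n s), (f ^ i) (g ⟨s, j⟩ • w ⟨s, j⟩) =
        (if hi : i < n s then g ⟨s, i, hi⟩ * c s else 0) • (s : V) := by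
      intro s
      have hz : ∀ j : Fin (n s), (j : ℕ) ≠ i → (f ^ i) (g ⟨s, j⟩ • w ⟨s, j⟩) = 0 := by
        intro j hj
        rcases lt_or_gt_of_ne hj with hj | hj
        · rw [map_smul, hlow s j hj, smul_zero]
        · have : g ⟨s, j⟩ = 0 := by
            by_contra h0
            exact absurd (hmax _ h0) (by simpa using hj)
          rw [this, zero_smul, map_zero]
      split_ifs with hi
      · rw [Finset.sum_eq_single ⟨i, hi⟩]
        · rw [map_smul, hfi, smul_smul]
        · intro j _ hj
          exact hz j fun h => hj (Fin.ext h)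
        · simp
      · rw [zero_smul]
        exact Finset.sum_eq_zero fun j _ => hz j (by omega)
    rw [Finset.sum_congr rfl fun s _ => h2 s] at h1
    have h3 := Fintype.linearIndependent_iff.1 hli _ h1 s₁
    rw [dif_pos i₁.2] at h3
    refine (mul_ne_zero hx₁ (mul_ne_zero (mul_ne_zero (by simp) ?_) ?_)) h3
    · have : i < d s₁ + 1 := i₁.2
      have := hd s₁
      exact factorial_cast_ne_zero p (by omega)
    · have : i < d s₁ + 1 := i₁.2
      have := hd s₁
      exact ascPochhammer_eval_neg_ne_zero p (by omega) (by omega)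
  have hwspan : ⊤ ≤ Submodule.span k (Set.range w) := by
    set W := Submodule.span k (Set.range w) with hW
    have hmem : ∀ (s : S) (i : ℕ), (e ^ i) (s : V) ∈ W := by
      intro s i
      by_cases hi : i < n s
      · exact Submodule.subset_span ⟨⟨s, i, hi⟩, rfl⟩
      · rw [← Nat.sub_add_cancel (not_lt.1 hi), pow_add, Module.End.mul_apply, hn, map_zero]
        exact zero_mem _
    have hKW : LinearMap.ker f ≤ W := by
      change K ≤ W
      rw [← hspanX, ← hspan, Submodule.span_le]
      intro s hs
      simpa using hmem ⟨s, hs⟩ 0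
    have heW : ∀ y ∈ W, e y ∈ W := by
      intro y hy
      induction hy using Submodule.span_induction with
      | mem y hy =>
        obtain ⟨x, rfl⟩ := hy
        have := hmem x.1 (x.2 + 1)
        rwa [pow_succ', Module.End.mul_apply] at this
      | zero => simp
      | add a b _ _ ha hb => rw [map_add]; exact W.add_mem ha hb
      | smul a b _ hb => rw [map_smul]; exact W.smul_mem a hb
    -- `V = ker f + e V` gives `V = W + e ^ m V` for all `m`, and `e` is nilpotent.
    have hiter : ∀ m : ℕ, ∀ y : V, ∃ z, y - (e ^ m) z ∈ W := by
      intro m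
      induction m with
      | zero => exact fun y => ⟨y, by simp⟩
      | succ m ih =>
        intro y
        have hy : y ∈ LinearMap.ker f ⊔ LinearMap.range e := by
          rw [t.ker_f_sup_range_e p he hf]; trivial
        obtain ⟨a, ha, _, ⟨c, rfl⟩, rfl⟩ := Submodule.mem_sup.1 hy
        obtain ⟨z, hz⟩ := ih c
        refine ⟨z, ?_⟩
        have : a + e c - (e ^ (m + 1)) z = a + e (c - (e ^ m) z) := by
          rw [pow_succ', Module.End.mul_apply, map_sub]; abel
        rw [this]
        exact W.add_mem (hKW ha) (heW _ hz)
    intro y _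
    obtain ⟨z, hz⟩ := hiter (p - 1) y
    simpa [he] using hz
  refine ⟨S, this, n, fun s => s, Basis.mk hwli hwspan, ⟨fun x => ?_, hn⟩, fun s => ⟨by simp [n],
    hfS s, ?_⟩⟩
  · rw [Basis.mk_apply]
  · rw [hhS]; simp [n]

/-- The triple is determined up to isomorphism by the ranks of the powers of `e`. -/
theorem IsTriple.exists_linearEquiv {e h f : End k V} {e' h' f' : End k V'} (t : IsTriple e h f)
    (t' : IsTriple e' h' f') (he : e ^ (p - 1) = 0) (hf : f ^ (p - 1) = 0)
    (he' : e' ^ (p - 1) = 0) (hf' : f' ^ (p - 1) = 0)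
    (hr : ∀ i, finrank k (LinearMap.range (e ^ i)) = finrank k (LinearMap.range (e' ^ i))) :
    ∃ ψ : V ≃ₗ[k] V', (∀ x, ψ (e x) = e' (ψ x)) ∧ ∀ x, ψ (f x) = f' (ψ x) := by
  obtain ⟨S, _, n, v, b, hb, hS⟩ := t.exists_isChainBasis p he hf
  obtain ⟨S', _, n', v', b', hb', hS'⟩ := t'.exists_isChainBasis p he' hf'
  have hcard : ∀ c, Nonempty ({s // n s = c} ≃ {s // n' s = c}) := by
    intro c
    rw [← Fintype.card_eq]
    cases c with
    | zero =>
      have : IsEmpty {s // n s = 0} := ⟨fun s => (hS s.1).1.ne' s.2⟩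
      have : IsEmpty {s // n' s = 0} := ⟨fun s => (hS' s.1).1.ne' s.2⟩
      rw [Fintype.card_eq_zero, Fintype.card_eq_zero]
    | succ i =>
      have h1 := hb.card_length_eq i
      have h2 := hb'.card_length_eq i
      rw [hr, hr, hr, ← h2] at h1
      exact_mod_cast h1
  let σ : S ≃ S' := (Equiv.sigmaFiberEquiv n).symm.trans
    ((Equiv.sigmaCongrRight fun c => (hcard c).some).trans (Equiv.sigmaFiberEquiv n'))
  have hσ : ∀ s, n' (σ s) = n s := fun s => ((hcard (n s)).some ⟨s, rfl⟩).2
  let ψ : V ≃ₗ[k] V' := b.equiv b' (Equiv.sigmaCongr σ fun s => finCongr (hσ s).symm)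
  have hψ : ∀ s i, ψ ((e ^ i) (v s)) = (e' ^ i) (v' (σ s)) := by
    intro s i
    by_cases hi : i < n s
    · have := b.equiv_apply (i := ⟨s, i, hi⟩) (b' := b') (e := Equiv.sigmaCongr σ fun s => finCongr (hσ s).symm)
      rwa [hb.apply_eq, hb'.apply_eq] at this
    · rw [hb.pow_apply_eq_zero (by omega), hb'.pow_apply_eq_zero (by rw [hσ]; omega), map_zero]
  refine ⟨ψ, fun x => ?_, fun x => ?_⟩
  · suffices ψ.toLinearMap ∘ₗ e = e' ∘ₗ ψ.toLinearMap from LinearMap.congr_fun this x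
    refine b.ext fun ⟨s, i⟩ => ?_
    change ψ (e (b _)) = e' (ψ (b _))
    rw [hb.apply_eq, hψ, ← Module.End.mul_apply, ← Module.End.mul_apply, ← pow_succ', ← pow_succ',
      hψ]
  · suffices ψ.toLinearMap ∘ₗ f = f' ∘ₗ ψ.toLinearMap from LinearMap.congr_fun this x
    refine b.ext fun ⟨s, i, hi⟩ => ?_
    change ψ (f (b _)) = f' (ψ (b _))
    rw [hb.apply_eq, hψ]
    change ψ (f ((e ^ i) (v s))) = f' ((e' ^ i) (v' (σ s)))
    cases i with
    | zero => simp [(hS s).2.1, (hS' (σ s)).2.1]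
    | succ i =>
      rw [t.f_e_pow_succ_of_lowest (hS s).2.1 (hS s).2.2,
        t'.f_e_pow_succ_of_lowest (hS' _).2.1 (hS' _).2.2, map_smul, hψ, hσ]

end Uniqueness

end Sl2Property

/-! ### Existence of Jordan bases -/

namespace Sl2Property

open Module Polynomial

section Jordan

universe u v
variable {k : Type u} {V : Type v} [Field k] [AddCommGroup V] [Module k V] [FiniteDimensional k V]

/-- Jordan normal form of a nilpotent endomorphism: the structure theorem for torsion modules over
`k[X]`. -/
theorem exists_isChainBasis_of_isNilpotent {e : End k V} (he : IsNilpotent e) :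
    ∃ (d : ℕ) (n : Fin d → ℕ) (v : Fin d → V) (b : Basis (Σ s, Fin (n s)) k V),
      IsChainBasis e n v b := by
  obtain ⟨r, hr⟩ := he
  have htors : Module.IsTorsion' (AEval' e) (Submonoid.powers (X : k[X])) := by
    intro x
    refine ⟨⟨X ^ r, r, rfl⟩, ?_⟩
    obtain ⟨x, rfl⟩ := (AEval'.of e).surjective x
    change (X ^ r : k[X]) • AEval'.of e x = 0
    rw [AEval'.X_pow_smul_of, hr, zero_smul, map_zero]
  obtain ⟨d, n, ⟨Φ⟩⟩ := Module.torsion_by_prime_power_decomposition irreducible_X htors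
  let Ψ := (AEval'.of e).trans (Φ.restrictScalars k)
  have hb₀ : ∀ s : Fin d, ∃ b : Basis (Fin (n s)) k (k[X] ⧸ k[X] ∙ (X : k[X]) ^ n s),
      ∀ i, b i = Submodule.Quotient.mk (X ^ (i : ℕ)) := by
    intro s
    have : ∃ b : Basis (Fin (n s)) k (AdjoinRoot ((X : k[X]) ^ n s)),
        ∀ i, b i = AdjoinRoot.mk _ (X ^ (i : ℕ)) := by
      refine ⟨(AdjoinRoot.powerBasis' (monic_X_pow (R := k) (n s))).basis.reindex
        (finCongr (by simp)), fun i => ?_⟩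
      rw [Basis.reindex_apply, PowerBasis.basis_eq_pow]
      simp
    exact this
  choose b₀ hb₀ using hb₀
  let b : Basis (Σ s, Fin (n s)) k V := (DFinsupp.basis b₀).map Ψ.symm
  let w : Fin d → DirectSum (Fin d) fun s => k[X] ⧸ k[X] ∙ (X : k[X]) ^ n s :=
    fun s => DirectSum.of _ s (Submodule.Quotient.mk 1)
  have hΨ : ∀ (i : ℕ) w, (e ^ i) (Ψ.symm w) = Ψ.symm ((X ^ i : k[X]) • w) := by
    intro i w
    obtain ⟨x, rfl⟩ := Ψ.surjective w
    rw [Ψ.symm_apply_apply, LinearEquiv.eq_symm_apply]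
    change Φ (AEval'.of e ((e ^ i) x)) = (X ^ i : k[X]) • Φ (AEval'.of e x)
    rw [← map_smul, AEval'.X_pow_smul_of]
    rfl
  have hsmul : ∀ s (q : k[X]), q • w s = DirectSum.of _ s (Submodule.Quotient.mk q) := by
    intro s q
    rw [← DirectSum.of_smul, ← Submodule.Quotient.mk_smul, smul_eq_mul, mul_one]
  refine ⟨d, n, fun s => Ψ.symm (w s), b, ?_, ?_⟩
  · rintro ⟨s, i⟩
    rw [hΨ, hsmul, Basis.map_apply]
    congr 1
    rw [← hb₀]
    apply (DFinsupp.basis b₀).repr.injective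
    rw [Basis.repr_self]
    apply (sigmaFinsuppLequivDFinsupp k).injective
    change sigmaFinsuppEquivDFinsupp _ = sigmaFinsuppLequivDFinsupp k
      ((sigmaFinsuppLequivDFinsupp k).symm
        (DFinsupp.mapRange.linearEquiv (fun s => (b₀ s).repr) (DFinsupp.single s (b₀ s i))))
    rw [LinearEquiv.apply_symm_apply, sigmaFinsuppEquivDFinsupp_single,
      DFinsupp.mapRange.linearEquiv_apply, DFinsupp.mapRange_single, Basis.repr_self]
  · intro s
    have h1 : (Submodule.Quotient.mk (X ^ n s) : k[X] ⧸ k[X] ∙ (X : k[X]) ^ n s) = 0 := by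
      rw [Submodule.Quotient.mk_eq_zero]
      exact Submodule.mem_span_singleton_self _
    rw [hΨ, hsmul, h1, map_zero, map_zero]

end Jordan

end Sl2Property

/-! ### A form for which the standard triple is skew -/

namespace Sl2Property

open Module

section Form

/-- Two matrices which, after a permutation of the columns, are block triangular with the same
diagonal blocks have simultaneously nonzero determinants. -/
theorem det_ne_zero_of_blockTriangular {k σ : Type*} [Field k] [Fintype σ] [DecidableEq σ]
    {A A₀ : Matrix σ σ k} (τ : Equiv.Perm σ) (w : σ → ℤ) (hA : ∀ x y, w y < w x → A x (τ y) = 0)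
    (hA₀ : ∀ x y, w y < w x → A₀ x (τ y) = 0) (h : ∀ x y, w x = w y → A₀ x (τ y) = A x (τ y))
    (hdet : A.det ≠ 0) : A₀.det ≠ 0 := by
  have key : (A₀.submatrix id τ).det = (A.submatrix id τ).det := by
    have h1 : (A.submatrix id τ).BlockTriangular w := fun x y hxy => hA x y hxy
    have h2 : (A₀.submatrix id τ).BlockTriangular w := fun x y hxy => hA₀ x y hxy
    rw [h1.det, h2.det]
    refine Finset.prod_congr rfl fun a _ => ?_
    congr 1
    ext x y
    exact h x y (x.2.trans y.2.symm)
  rw [Matrix.det_permute', Matrix.det_permute'] at key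
  intro h0
  rw [h0, mul_zero, eq_comm, mul_eq_zero] at key
  refine key.elim (fun hs => ?_) hdet
  rcases Int.units_eq_one_or (Equiv.Perm.sign τ) with h | h <;> simp [h] at hs

variable {k V S : Type*} [Field k] [AddCommGroup V] [Module k V]
  {e : End k V} {n : S → ℕ} {v : S → V} {b : Basis (Σ s, Fin (n s)) k V}

theorem skew_pow {B : LinearMap.BilinForm k V} (hskew : ∀ x y, B (e x) y = -B x (e y)) (i : ℕ)
    (x y : V) : B ((e ^ i) x) y = (-1) ^ i * B x ((e ^ i) y) := by
  induction i generalizing x y with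
  | zero => simp
  | succ i ih =>
    rw [pow_succ', Module.End.mul_apply, hskew, ih, ← Module.End.mul_apply, ← pow_succ,
      ← pow_succ']
    ring

/-- The lowering operator and the weight operator of the standard `sl₂`-triple attached to a Jordan
basis. -/
theorem IsChainBasis.exists_isTriple (hb : IsChainBasis e n v b) {r : ℕ} (hr : e ^ r = 0) :
    ∃ h f : End k V, IsTriple e h f ∧ f ^ r = 0 ∧
      ∀ s (i : ℕ), i ≤ n s → f ((e ^ i) (v s)) = (i * (n s - i) : k) • (e ^ (i - 1)) (v s) := by
  let f : End k V := b.constr k fun x =>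
    ((x.2 : ℕ) * (n x.1 - (x.2 : ℕ)) : k) • (e ^ (x.2 - 1 : ℕ)) (v x.1)
  have hf : ∀ s (i : ℕ), i ≤ n s → f ((e ^ i) (v s)) = (i * (n s - i) : k) • (e ^ (i - 1)) (v s) := by
    intro s i hi
    rcases hi.lt_or_eq with h | h
    · have := b.constr_basis k (fun x : Σ s, Fin (n s) =>
        ((x.2 : ℕ) * (n x.1 - (x.2 : ℕ)) : k) • (e ^ (x.2 - 1 : ℕ)) (v x.1)) ⟨s, i, h⟩
      rwa [hb.apply_eq] at this
    · rw [hb.pow_apply_eq_zero h.ge, map_zero, h]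
      simp
  let h : End k V := e * f - f * e
  have hh : ∀ s (i : ℕ), h ((e ^ i) (v s)) = (2 * i - n s + 1 : k) • (e ^ i) (v s) := by
    intro s i
    by_cases hi : i < n s
    · change e (f ((e ^ i) (v s))) - f (e ((e ^ i) (v s))) = _
      rw [← Module.End.mul_apply e (e ^ i), ← pow_succ', hf s i hi.le, hf s (i + 1) hi,
        Nat.add_sub_cancel]
      cases i with
      | zero =>
        simp only [Nat.cast_zero, map_smul]
        push_cast
        module
      | succ i =>
        rw [map_smul, Nat.add_sub_cancel, ← Module.End.mul_apply e (e ^ i), ← pow_succ']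
        push_cast
        module
    · rw [hb.pow_apply_eq_zero (not_lt.1 hi), map_zero, smul_zero]
  refine ⟨h, f, ⟨?_, ?_, ?_⟩, ?_, hf⟩
  · rw [LieRing.of_associative_ring_bracket]
    refine b.ext fun x => ?_
    rw [hb.apply_eq]
    change h (e _) - e (h _) = (2 • e) _
    rw [hh, ← Module.End.mul_apply e, ← pow_succ', hh, map_smul, ← Module.End.mul_apply e,
      ← pow_succ', LinearMap.smul_apply, ← Module.End.mul_apply e, ← pow_succ',
      ← Nat.cast_smul_eq_nsmul k]
    push_cast
    module
  · rw [LieRing.of_associative_ring_bracket]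
    refine b.ext fun ⟨s, i, hi⟩ => ?_
    rw [hb.apply_eq]
    change h (f ((e ^ i) (v s))) - f (h ((e ^ i) (v s))) = -(2 • f ((e ^ i) (v s)))
    rw [hh, hf s i hi.le, map_smul, map_smul, hf s i hi.le, hh, ← Nat.cast_smul_eq_nsmul k]
    cases i with
    | zero => simp
    | succ i =>
      simp only [Nat.add_sub_cancel]
      push_cast
      module
  · rw [LieRing.of_associative_ring_bracket]
  · have hfz : ∀ m s i, i < m → i < n s → (f ^ m) ((e ^ i) (v s)) = 0 := by
      intro m s
      induction m with
      | zero => intro i hi; omega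
      | succ m ih =>
        intro i hi hin
        rw [pow_succ, Module.End.mul_apply, hf s i hin.le, map_smul]
        cases i with
        | zero => simp
        | succ i => rw [Nat.add_sub_cancel, ih i (by omega) (by omega), smul_zero]
    refine b.ext fun x => ?_
    rw [hb.apply_eq, hfz _ _ _ (lt_of_lt_of_le x.2.2 (hb.length_le hr x.1)) x.2.2,
      LinearMap.zero_apply]

/-- The part of degree zero of a form for which `e` is skew, for the weights of the standard
`sl₂`-triple attached to a Jordan basis. It is nondegenerate because the form has no part of
positive degree. -/
theorem IsChainBasis.exists_nondegenerate_degree_zero [Fintype S] (hb : IsChainBasis e n v b)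
    {B : LinearMap.BilinForm k V} (hB : B.Nondegenerate) (hskew : ∀ x y, B (e x) y = -B x (e y)) :
    ∃ B₀ : LinearMap.BilinForm k V, B₀.Nondegenerate ∧ ∀ s t (i j : ℕ),
      B₀ ((e ^ i) (v s)) ((e ^ j) (v t)) =
        if n s = n t ∧ i + j + 1 = n s then B ((e ^ i) (v s)) ((e ^ j) (v t)) else 0 := by
  classical
  have hB0 : ∀ s t (i j : ℕ), n s ≤ i + j ∨ n t ≤ i + j → B ((e ^ i) (v s)) ((e ^ j) (v t)) = 0 := by
    intro s t i j hst
    rcases hst with h | h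
    · have h1 := skew_pow hskew j ((e ^ i) (v s)) (v t)
      rw [← Module.End.mul_apply, ← pow_add, hb.pow_apply_eq_zero (by omega), map_zero,
        LinearMap.zero_apply, eq_comm, mul_eq_zero] at h1
      exact h1.resolve_left (by simp)
    · rw [skew_pow hskew, ← Module.End.mul_apply, ← pow_add, hb.pow_apply_eq_zero h, map_zero,
        mul_zero]
  let M : Matrix (Σ s, Fin (n s)) (Σ s, Fin (n s)) k := fun x y =>
    if n x.1 = n y.1 ∧ (x.2 + y.2 + 1 : ℕ) = n x.1 then B (b x) (b y) else 0
  let B₀ : LinearMap.BilinForm k V := Matrix.toBilin b M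
  have hBM : ∀ x y, B₀ (b x) (b y) = M x y := fun x y => by
    rw [← LinearMap.BilinForm.toMatrix_apply, LinearMap.BilinForm.toMatrix_toBilin]
  have hBe : ∀ s t (i j : ℕ), B₀ ((e ^ i) (v s)) ((e ^ j) (v t)) =
      if n s = n t ∧ i + j + 1 = n s then B ((e ^ i) (v s)) ((e ^ j) (v t)) else 0 := by
    intro s t i j
    by_cases hi : i < n s
    · by_cases hj : j < n t
      · have := hBM ⟨s, i, hi⟩ ⟨t, j, hj⟩
        simp only [hb.apply_eq, M] at this
        exact this
      · rw [hb.pow_apply_eq_zero (not_lt.1 hj), map_zero, if_neg (by omega)]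
    · rw [hb.pow_apply_eq_zero (not_lt.1 hi), map_zero, LinearMap.zero_apply,
        if_neg (by omega)]
  refine ⟨B₀, ?_, hBe⟩
  rw [LinearMap.BilinForm.nondegenerate_iff_det_ne_zero b]
  rw [LinearMap.BilinForm.nondegenerate_iff_det_ne_zero b] at hB
  let τ : Equiv.Perm (Σ s, Fin (n s)) := Equiv.sigmaCongrRight fun s => Fin.revPerm
  have hτ : ∀ t j hj, τ ⟨t, j, hj⟩ = ⟨t, n t - (j + 1), by omega⟩ := fun _ _ _ => rfl
  refine det_ne_zero_of_blockTriangular τ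
    (fun x => 2 * (x.2 : ℕ) - n x.1) ?_ ?_ ?_ hB
  · rintro ⟨s, i, hi⟩ ⟨t, j, hj⟩ hlt
    rw [hτ, LinearMap.BilinForm.toMatrix_apply, hb.apply_eq, hb.apply_eq]
    apply hB0
    dsimp only at hlt ⊢
    omega
  · rintro ⟨s, i, hi⟩ ⟨t, j, hj⟩ hlt
    rw [hτ, LinearMap.BilinForm.toMatrix_apply, hb.apply_eq, hb.apply_eq, hBe, if_neg]
    dsimp only at hlt ⊢
    omega
  · rintro ⟨s, i, hi⟩ ⟨t, j, hj⟩ heq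
    rw [hτ, LinearMap.BilinForm.toMatrix_apply, LinearMap.BilinForm.toMatrix_apply, hb.apply_eq,
      hb.apply_eq, hBe]
    split_ifs with hc
    · rfl
    · symm
      apply hB0
      dsimp only at heq hc ⊢
      omega

/-- For the degree zero part of a form, the whole standard triple is skew: this part pairs only chains
of equal length, and there the coefficients `i (n - i)` of `f` are symmetric under `i ↦ n - i`. -/
theorem IsChainBasis.exists_form [Fintype S] (hb : IsChainBasis e n v b) {ε : k}
    {B : LinearMap.BilinForm k V}
    (hB : B.Nondegenerate) (hε : ∀ x y, B x y = ε * B y x)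
    (hskew : ∀ x y, B (e x) y = -B x (e y)) {r : ℕ} (hr : e ^ r = 0) :
    ∃ (B₀ : LinearMap.BilinForm k V) (h f : End k V), B₀.Nondegenerate ∧
      (∀ x y, B₀ x y = ε * B₀ y x) ∧ (∀ x y, B₀ (e x) y = -B₀ x (e y)) ∧
      (∀ x y, B₀ (f x) y = -B₀ x (f y)) ∧ IsTriple e h f ∧ f ^ r = 0 := by
  obtain ⟨B₀, hB₀, hBe⟩ := hb.exists_nondegenerate_degree_zero hB hskew
  have extB : ∀ C D : LinearMap.BilinForm k V, (∀ s t (i j : ℕ), i < n s → j < n t →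
      C ((e ^ i) (v s)) ((e ^ j) (v t)) = D ((e ^ i) (v s)) ((e ^ j) (v t))) → C = D := by
    intro C D hCD
    refine LinearMap.BilinForm.ext_basis b fun x y => ?_
    rw [hb.apply_eq, hb.apply_eq]
    exact hCD _ _ _ _ x.2.2 y.2.2
  obtain ⟨h, f, ht, hfr, hf⟩ := hb.exists_isTriple hr
  refine ⟨B₀, h, f, hB₀, ?_, ?_, ?_, ht, hfr⟩
  · suffices h : B₀ = ε • LinearMap.flip B₀ from fun x y => LinearMap.congr_fun₂ h x y
    refine extB _ _ fun s t i j _ _ => ?_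
    change _ = ε * B₀ _ _
    rw [hBe, hBe]
    split_ifs with h1 h2 h2
    · exact hε _ _
    · omega
    · omega
    · rw [mul_zero]
  · suffices B₀ ∘ₗ e = -B₀.compl₂ e from fun x y => LinearMap.congr_fun₂ this x y
    refine extB _ _ fun s t i j _ _ => ?_
    change B₀ (e _) _ = -B₀ _ (e _)
    rw [← Module.End.mul_apply e, ← Module.End.mul_apply e, ← pow_succ', ← pow_succ', hBe, hBe,
      pow_succ', pow_succ', Module.End.mul_apply e, Module.End.mul_apply e, hskew]
    split_ifs with h1 h2 h2
    · rfl
    · omega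
    · omega
    · rw [neg_zero]
  · suffices B₀ ∘ₗ f = -B₀.compl₂ f from fun x y => LinearMap.congr_fun₂ this x y
    refine extB _ _ fun s t i j hi hj => ?_
    change B₀ (f _) _ = -B₀ _ (f _)
    rw [hf s i hi.le, hf t j hj.le, map_smul, map_smul, LinearMap.smul_apply, hBe, hBe]
    cases i with
    | zero =>
      cases j with
      | zero => simp
      | succ j =>
        rw [if_neg (by omega : ¬(n s = n t ∧ 0 + (j + 1 - 1) + 1 = n s))]
        simp
    | succ i =>
      cases j with
      | zero => rw [if_neg (by omega)]; simp
      | succ j =>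
        simp only [Nat.add_sub_cancel]
        by_cases hc : n s = n t ∧ i + j + 2 = n s
        · rw [if_pos (by omega), if_pos (by omega), pow_succ', pow_succ', Module.End.mul_apply e,
            Module.End.mul_apply e, hskew, ← hc.1, ← hc.2]
          simp only [smul_eq_mul]
          push_cast
          ring
        · rw [if_neg (by omega), if_neg (by omega), smul_zero, smul_zero, neg_zero]

end Form

end Sl2Property

/-! ### Square roots and equivalence of forms -/

namespace Sl2Property

open Matrix Polynomial

section SquareRoot

variable {k ι : Type*} [Field k] [IsAlgClosed k] [Fintype ι] [DecidableEq ι]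

/-- An invertible matrix over an algebraically closed field of characteristic not two has a
square root that is a polynomial in it: interpolate square roots of the eigenvalues, and
lift the resulting square root modulo nilpotents by Newton's method. -/
theorem exists_aeval_sq_eq (h2 : (2 : k) ≠ 0) {s : Matrix ι ι k} (hs : s.det ≠ 0) :
    ∃ q : k[X], aeval s q * aeval s q = s := by
  classical
  set χ := s.charpoly with hχ
  have hχ0 : χ ≠ 0 := s.charpoly_monic.ne_zero
  choose ρ hρ using fun a : k => IsAlgClosed.exists_pow_nat_eq a (n := 2) two_pos
  let Λ : Finset k := χ.roots.toFinset
  let q : k[X] := Lagrange.interpolate Λ id ρ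
  have hq : ∀ a, χ.IsRoot a → q.eval a = ρ a := fun a ha =>
    Lagrange.eval_interpolate_at_node ρ (Set.injOn_id _) (by simpa [Λ, hχ0] using ha)
  have hroot : ∀ a, χ.IsRoot a → a ≠ 0 := by
    rintro a ha rfl
    apply hs
    rw [Matrix.det_eq_sign_charpoly_coeff, coeff_zero_eq_eval_zero, ← hχ, ha.eq_zero, mul_zero]
  have hcop : IsCoprime q χ := by
    rw [Polynomial.isCoprime_iff_aeval_ne_zero_of_isAlgClosed k k]
    intro a
    by_contra! h
    simp only [coe_aeval_eq_eval] at h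
    have h1 := hq a h.2
    rw [h.1] at h1
    have h3 := hρ a
    rw [← h1] at h3
    exact hroot a h.2 (by rw [← h3]; simp)
  have hdvd : ∃ m : ℕ, χ ∣ (q ^ 2 - X) ^ m := by
    refine ⟨Multiset.card χ.roots, ?_⟩
    conv_lhs => rw [(IsAlgClosed.splits χ).eq_prod_roots_of_monic s.charpoly_monic]
    rw [← Multiset.prod_replicate, ← Multiset.map_const']
    refine Multiset.prod_dvd_prod_of_dvd _ _ fun a ha => ?_
    have ha := isRoot_of_mem_roots ha
    rw [dvd_iff_isRoot, IsRoot.def, eval_sub, eval_pow, eval_X, hq a ha, hρ, sub_self]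
  let A := Algebra.adjoin k {s}
  let x : A := ⟨s, Algebra.self_mem_adjoin_singleton k s⟩
  have hxs : ∀ g : k[X], ((aeval x g : A) : Matrix ι ι k) = aeval s g := fun g => by
    rw [← Subalgebra.coe_val, ← Polynomial.aeval_algHom_apply]
    rfl
  have hχs : aeval x χ = 0 := Subtype.ext (by rw [hxs]; exact s.aeval_self_charpoly)
  let P : A[X] := X ^ 2 - C x
  obtain ⟨m, hm⟩ := hdvd
  have hnil : IsNilpotent (aeval (aeval x q) P) := by
    refine ⟨m, ?_⟩
    obtain ⟨g, hg⟩ := hm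
    have := congrArg (aeval x) hg
    rw [map_mul, hχs, zero_mul] at this
    simpa [P] using this
  have hunit : IsUnit (aeval (aeval x q) (derivative P)) := by
    obtain ⟨a, c, hac⟩ := hcop
    have := congrArg (aeval x) hac
    rw [map_add, map_mul, map_mul, hχs, mul_zero, add_zero, map_one] at this
    have hu : IsUnit (aeval x q) := IsUnit.of_mul_eq_one_right _ this
    have h2u : IsUnit (2 : A) := by
      have := (IsUnit.mk0 (2 : k) h2).map (algebraMap k A)
      rwa [map_ofNat] at this
    simpa [P, one_add_one_eq_two] using h2u.mul hu
  obtain ⟨r, ⟨-, hr⟩, -⟩ := existsUnique_nilpotent_sub_and_aeval_eq_zero hnil hunit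
  have hr2 : (r : Matrix ι ι k) * r = s := by
    have : r ^ 2 = x := by simpa [P, sub_eq_zero] using hr
    have := congrArg (Subtype.val) this
    simpa [sq, x] using this
  have hmem : (r : Matrix ι ι k) ∈ (aeval (R := k) s).range := by
    rw [← Algebra.adjoin_singleton_eq_range_aeval]
    exact r.2
  obtain ⟨g, hg⟩ := hmem
  exact ⟨g, by rw [show aeval s g = r from hg, hr2]⟩

/-- Two nondegenerate forms of the same symmetry type are related by a change of basis that commutes
with every matrix which is skew for both of them. -/
theorem exists_transpose_mul_mul_eq (h2 : (2 : k) ≠ 0) {ε : k} (hε : ε * ε = 1)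
    {B C : Matrix ι ι k} (hB : B.det ≠ 0) (hC : C.det ≠ 0) (hBt : Bᵀ = ε • B) (hCt : Cᵀ = ε • C) :
    ∃ r : GL ι k, r.1ᵀ * B * r.1 = C ∧ ∀ x, xᵀ * B = -(B * x) → xᵀ * C = -(C * x) →
      x * r.1 = r.1 * x := by
  have hBu : IsUnit B.det := IsUnit.mk0 _ hB
  set s := B⁻¹ * C with hs
  have hBs : B * s = C := by rw [hs, Matrix.mul_nonsing_inv_cancel_left _ _ hBu]
  have hsB : sᵀ * B = B * s := by
    have h1 : C = sᵀ * B := by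
      have := congrArg Matrix.transpose hBs
      rw [Matrix.transpose_mul, hBt, hCt, Matrix.mul_smul] at this
      have := congrArg (ε • ·) this
      simpa [smul_smul, hε] using this.symm
    rw [← h1, hBs]
  have hsdet : s.det ≠ 0 := by
    rw [hs, Matrix.det_mul, Matrix.det_nonsing_inv, Ring.inverse_eq_inv']
    exact mul_ne_zero (inv_ne_zero hB) hC
  obtain ⟨q, hq⟩ := exists_aeval_sq_eq h2 hsdet
  set r := aeval s q with hr
  have hrdet : r.det ≠ 0 := by
    intro h0
    apply hsdet
    rw [← hq, Matrix.det_mul, h0, zero_mul]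
  have hrB : ∀ g : k[X], (aeval s g)ᵀ * B = B * aeval s g := by
    intro g
    induction g using Polynomial.induction_on' with
    | add a b ha hb => simp [add_mul, mul_add, ha, hb]
    | monomial m a =>
      have : ∀ m : ℕ, (s ^ m)ᵀ * B = B * s ^ m := by
        intro m
        induction m with
        | zero => simp
        | succ m ih =>
          rw [pow_succ, Matrix.transpose_mul, mul_assoc, ih, ← mul_assoc, hsB, mul_assoc,
            ← pow_succ', ← pow_succ]
      rw [aeval_monomial, ← Algebra.smul_def, Matrix.transpose_smul, Matrix.smul_mul, this,
        Matrix.mul_smul]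
  refine ⟨Matrix.GeneralLinearGroup.mkOfDetNeZero r hrdet, ?_, fun x hxB hxC => ?_⟩
  · change rᵀ * B * r = C
    rw [hr, hrB, mul_assoc, hq, hBs]
  · change x * r = r * x
    have hxs : x * s = s * x := by
      have h1 : B * (x * s) = B * (s * x) := by
        rw [← mul_assoc, ← mul_assoc B s, hBs, ← neg_inj, ← hxC, ← neg_mul, ← hxB, mul_assoc, hBs]
      have := congrArg (B⁻¹ * ·) h1
      simpa only [Matrix.nonsing_inv_mul_cancel_left _ _ hBu] using this
    have hcomm : ∀ g : k[X], Commute x (aeval s g) := by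
      intro g
      induction g using Polynomial.induction_on' with
      | add a b ha hb => rw [map_add]; exact ha.add_right hb
      | monomial m a =>
        rw [aeval_monomial, ← Algebra.smul_def]
        exact ((show Commute x s from hxs).pow_right m).smul_right a
    exact hcomm q

end SquareRoot

end Sl2Property

/-! ### Conjugacy under the isometry group -/

namespace Sl2Property

open Matrix Module

section Isometry

variable {k ι : Type*} [Field k] [Fintype ι] [DecidableEq ι]

theorem mem_skewAdjoint_iff {B x : Matrix ι ι k} :
    x ∈ skewAdjointMatricesLieSubalgebra B ↔ xᵀ * B = -(B * x) := by
  rw [mem_skewAdjointMatricesLieSubalgebra, mem_skewAdjointMatricesSubmodule, Matrix.IsSkewAdjoint,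
    Matrix.IsAdjointPair, Matrix.mul_neg]

theorem IsTriple.map {R R' : Type*} [Ring R] [Ring R'] (φ : R →+* R') {e h f : R}
    (t : IsTriple e h f) : IsTriple (φ e) (φ h) (φ f) := by
  obtain ⟨h1, h2, h3⟩ := t
  rw [LieRing.of_associative_ring_bracket] at h1 h2 h3
  refine ⟨?_, ?_, ?_⟩ <;> rw [LieRing.of_associative_ring_bracket, ← map_mul, ← map_mul, ← map_sub]
  · rw [h1, map_nsmul]
  · rw [h2, map_neg, map_nsmul]
  · rw [h3]

theorem Ad_mul_apply (g : GL ι k) (x y : Matrix ι ι k) : Ad g (x * y) = Ad g x * Ad g y := by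
  simp [Ad, mul_assoc]

theorem Ad_lie (g : GL ι k) (x y : Matrix ι ι k) : Ad g ⁅x, y⁆ = ⁅Ad g x, Ad g y⁆ := by
  rw [LieRing.of_associative_ring_bracket, LieRing.of_associative_ring_bracket, ← Ad_mul_apply,
    ← Ad_mul_apply]
  simp [Ad, mul_sub, sub_mul]

theorem Ad_pow (g : GL ι k) (x : Matrix ι ι k) (i : ℕ) : Ad g x ^ i = Ad g (x ^ i) := by
  induction i with
  | zero => simp [Ad]
  | succ i ih => rw [pow_succ, ih, ← Ad_mul_apply, ← pow_succ]

theorem Ad_eq_iff {g : GL ι k} {x y : Matrix ι ι k} : Ad g x = y ↔ g.1 * x = y * g.1 := by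
  constructor
  · rintro rfl
    simp [Ad, mul_assoc]
  · intro h
    rw [Ad, h, mul_assoc]
    simp

theorem rank_Ad (g : GL ι k) (x : Matrix ι ι k) : (Ad g x).rank = x.rank := by
  rw [Ad, Matrix.rank_mul_eq_left_of_isUnit_det _ _
    ((Matrix.isUnit_iff_isUnit_det _).1 (g⁻¹).isUnit),
    Matrix.rank_mul_eq_right_of_isUnit_det _ _ ((Matrix.isUnit_iff_isUnit_det _).1 g.isUnit)]

/-- Uniqueness in `GL_n`: two triples with conjugate `e` are conjugate. -/
theorem exists_conj_of_Ad_eq (p : ℕ) [CharP k p] [Fact p.Prime] {e h f e' h' f' : Matrix ι ι k}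
    (t : IsTriple e h f) (t' : IsTriple e' h' f') (he : e ^ (p - 1) = 0) (hf : f ^ (p - 1) = 0)
    (he' : e' ^ (p - 1) = 0) (hf' : f' ^ (p - 1) = 0) {g : GL ι k} (hg : Ad g e = e') :
    ∃ u : GL ι k, u.1 * e = e' * u.1 ∧ u.1 * f = f' * u.1 := by
  let L : Matrix ι ι k →+* End k (ι → k) :=
    ((Matrix.toLinAlgEquiv' : _ ≃ₐ[k] _).toRingEquiv : Matrix ι ι k ≃+* End k (ι → k))
  have hL : ∀ x v, L x v = x *ᵥ v := fun x v => Matrix.toLin'_apply x v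
  have hr : ∀ i, finrank k (LinearMap.range (L e ^ i)) =
      finrank k (LinearMap.range (L e' ^ i)) := by
    intro i
    rw [← map_pow, ← map_pow]
    change (e ^ i).rank = (e' ^ i).rank
    rw [← hg, Ad_pow, rank_Ad]
  have hz : ∀ {x : Matrix ι ι k}, x ^ (p - 1) = 0 → L x ^ (p - 1) = 0 := fun hx => by
    rw [← map_pow, hx, map_zero]
  obtain ⟨ψ, hψe, hψf⟩ := (t.map L).exists_linearEquiv p (t'.map L) (hz he) (hz hf) (hz he')
    (hz hf') hr
  let u : GL ι k := ⟨LinearMap.toMatrix' ψ.toLinearMap, LinearMap.toMatrix' ψ.symm.toLinearMap,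
    by rw [← LinearMap.toMatrix'_comp]; simp, by rw [← LinearMap.toMatrix'_comp]; simp⟩
  have hu : ∀ v, u.1 *ᵥ v = ψ v := fun v => LinearMap.toMatrix'_mulVec _ v
  have key : ∀ x y, (∀ v, ψ (L x v) = L y (ψ v)) → u.1 * x = y * u.1 := by
    intro x y hxy
    apply Matrix.toLin'.injective
    refine LinearMap.ext fun v => ?_
    rw [Matrix.toLin'_apply, Matrix.toLin'_apply, ← Matrix.mulVec_mulVec, ← Matrix.mulVec_mulVec,
      hu, hu, ← hL, ← hL, hxy]
  exact ⟨u, key _ _ hψe, key _ _ hψf⟩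

variable [IsAlgClosed k]

/-- Skew matrices that are conjugate under `GL_n` are conjugate under the isometry group, and the
conjugating isometry depends only on the element of `GL_n`, so that it conjugates whole tuples. -/
theorem exists_isometry_of_conj (h2 : (2 : k) ≠ 0) {ε : k} (hε : ε * ε = 1) {B : Matrix ι ι k}
    (hB : B.det ≠ 0) (hBt : Bᵀ = ε • B) (g : GL ι k) :
    ∃ u : GL ι k, u.1ᵀ * B * u.1 = B ∧ ∀ x y, xᵀ * B = -(B * x) → yᵀ * B = -(B * y) →
      g.1 * x = y * g.1 → Ad u x = y := by
  have hgdet : g.1.det ≠ 0 := ((Matrix.isUnit_iff_isUnit_det _).1 g.isUnit).ne_zero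
  have hCdet : (g.1ᵀ * B * g.1).det ≠ 0 := by
    rw [Matrix.det_mul, Matrix.det_mul, Matrix.det_transpose]
    exact mul_ne_zero (mul_ne_zero hgdet hB) hgdet
  have hCt : (g.1ᵀ * B * g.1)ᵀ = ε • (g.1ᵀ * B * g.1) := by
    rw [Matrix.transpose_mul, Matrix.transpose_mul, Matrix.transpose_transpose, hBt]
    simp [mul_assoc]
  obtain ⟨r, hr, hcomm⟩ := exists_transpose_mul_mul_eq h2 hε hB hCdet hBt hCt
  have hrr : r.1 * (r⁻¹).1 = 1 := r.mul_inv
  refine ⟨g * r⁻¹, ?_, fun x y hx hy hxy => ?_⟩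
  · rw [Units.val_mul, Matrix.transpose_mul]
    calc (r⁻¹).1ᵀ * g.1ᵀ * B * (g.1 * (r⁻¹).1) = (r⁻¹).1ᵀ * (g.1ᵀ * B * g.1) * (r⁻¹).1 := by
          simp only [mul_assoc]
      _ = (r.1 * (r⁻¹).1)ᵀ * B * (r.1 * (r⁻¹).1) := by
          rw [← hr, Matrix.transpose_mul]; simp only [mul_assoc]
      _ = B := by rw [hrr]; simp
  · have hxC : xᵀ * (g.1ᵀ * B * g.1) = -(g.1ᵀ * B * g.1 * x) := by
      calc xᵀ * (g.1ᵀ * B * g.1) = (g.1 * x)ᵀ * B * g.1 := by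
            rw [Matrix.transpose_mul]; simp only [mul_assoc]
        _ = g.1ᵀ * (yᵀ * B) * g.1 := by rw [hxy, Matrix.transpose_mul]; simp only [mul_assoc]
        _ = -(g.1ᵀ * B * (y * g.1)) := by rw [hy]; simp only [mul_neg, neg_mul, mul_assoc]
        _ = _ := by rw [← hxy]; simp only [mul_assoc]
    have h1 : Ad r⁻¹ x = x := by
      apply Ad_inv_of_eq
      rw [Ad_eq_iff, hcomm x hx hxC]
    rw [Ad_mul, h1, Ad_eq_iff, hxy]

/-- Jacobson–Morozov for the Lie algebra of skew matrices. -/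
theorem exists_isTriple_of_skew (h2 : (2 : k) ≠ 0) {ε : k} (hε : ε * ε = 1) {B : Matrix ι ι k}
    (hB : B.det ≠ 0) (hBt : Bᵀ = ε • B) {e : Matrix ι ι k} (he : eᵀ * B = -(B * e)) {r : ℕ}
    (hr : e ^ r = 0) :
    ∃ h f : Matrix ι ι k, IsTriple e h f ∧ fᵀ * B = -(B * f) ∧ f ^ r = 0 := by
  let L : Matrix ι ι k ≃+* End k (ι → k) := (Matrix.toLinAlgEquiv' : _ ≃ₐ[k] _).toRingEquiv
  have hL : ∀ x v, L x v = x *ᵥ v := fun x v => Matrix.toLin'_apply x v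
  have hLr : L e ^ r = 0 := by rw [← map_pow, hr, map_zero]
  have hdot : ∀ (M x : Matrix ι ι k) v w, (L x v) ⬝ᵥ M *ᵥ w = v ⬝ᵥ (xᵀ * M) *ᵥ w := by
    intro M x v w
    rw [hL, ← Matrix.mulVec_mulVec, Matrix.dotProduct_mulVec v, Matrix.vecMul_transpose]
  obtain ⟨d, n, v, b, hb⟩ := exists_isChainBasis_of_isNilpotent ⟨r, hLr⟩
  obtain ⟨B₀, h₀, f₀, hnd, hε₀, hskewe, hskewf, t, hf₀⟩ := hb.exists_form (ε := ε)
    (B := Matrix.toBilin' B) (LinearMap.BilinForm.nondegenerate_toBilin'_of_det_ne_zero' B hB)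
    (fun x y => by
      rw [Matrix.toBilin'_apply', Matrix.toBilin'_apply', Matrix.dotProduct_mulVec,
        dotProduct_comm, ← Matrix.mulVec_transpose, hBt, Matrix.smul_mulVec, dotProduct_smul,
        smul_eq_mul])
    (fun x y => by
      rw [Matrix.toBilin'_apply', Matrix.toBilin'_apply', hdot, he, hL, Matrix.mulVec_mulVec,
        Matrix.neg_mulVec, dotProduct_neg]) hLr
  set C := LinearMap.BilinForm.toMatrix' B₀ with hCdef
  have hBC : ∀ x y, B₀ x y = x ⬝ᵥ C *ᵥ y := fun x y => by
    rw [← Matrix.toBilin'_apply', hCdef, Matrix.toBilin'_toMatrix']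
  have hskewC : ∀ x : Matrix ι ι k, (∀ v w, B₀ (L x v) w = -B₀ v (L x w)) →
      xᵀ * C = -(C * x) := by
    intro x hx
    apply Matrix.toBilin'.injective
    refine LinearMap.ext₂ fun v w => ?_
    rw [Matrix.toBilin'_apply', Matrix.toBilin'_apply', ← hdot, ← hBC, hx, hBC, hL,
      Matrix.mulVec_mulVec, Matrix.neg_mulVec, dotProduct_neg]
  have hCdet : C.det ≠ 0 := by
    rw [← LinearMap.BilinForm.nondegenerate_toBilin'_iff_det_ne_zero, hCdef,
      Matrix.toBilin'_toMatrix']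
    exact hnd
  have hCt : Cᵀ = ε • C := by
    ext i j
    rw [Matrix.transpose_apply, Matrix.smul_apply, hCdef, LinearMap.BilinForm.toMatrix'_apply,
      LinearMap.BilinForm.toMatrix'_apply, hε₀, smul_eq_mul]
  -- `B₀` is carried to the given form by a matrix that commutes with `e`.
  obtain ⟨u, hu, hcomm⟩ := exists_transpose_mul_mul_eq h2 hε hCdet hB hCt hBt
  have heC := hskewC e hskewe
  set f := L.symm f₀ with hf
  have hfC : fᵀ * C = -(C * f) := hskewC f (by rw [hf, L.apply_symm_apply]; exact hskewf)
  have huu : u.1 * (u⁻¹).1 = 1 := u.mul_inv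
  have hAde : Ad u⁻¹ e = e := by
    apply Ad_inv_of_eq
    rw [Ad_eq_iff, hcomm e heC he]
  have ht : IsTriple e (L.symm h₀) f := by
    have := t.map (L.symm : End k (ι → k) →+* Matrix ι ι k)
    simpa using this
  refine ⟨Ad u⁻¹ (L.symm h₀), Ad u⁻¹ f, ?_, ?_, ?_⟩
  · have h1 : ∀ x, Ad u⁻¹ (2 • x) = 2 • Ad u⁻¹ x := fun x => by
      rw [Ad, mul_smul_comm, smul_mul_assoc, Ad]
    have h3 : ∀ x, Ad u⁻¹ (-x) = -Ad u⁻¹ x := fun x => by simp [Ad]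
    refine ⟨?_, ?_, ?_⟩
    · conv_lhs => rw [← hAde]
      rw [← Ad_lie, ht.lie_h_e, h1, hAde]
    · rw [← Ad_lie, ht.lie_h_f, h3, h1]
    · conv_lhs => rw [← hAde]
      rw [← Ad_lie, ht.lie_e_f]
  · rw [Ad, inv_inv, ← hu]
    calc ((u⁻¹).1 * f * u.1)ᵀ * (u.1ᵀ * C * u.1)
        = u.1ᵀ * fᵀ * (u.1 * (u⁻¹).1)ᵀ * C * u.1 := by
          simp only [Matrix.transpose_mul, mul_assoc]
      _ = u.1ᵀ * (fᵀ * C) * u.1 := by rw [huu]; simp [mul_assoc]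
      _ = -(u.1ᵀ * C * (u.1 * (u⁻¹).1) * f * u.1) := by rw [hfC, huu]; simp [mul_assoc]
      _ = _ := by simp only [mul_assoc]
  · rw [Ad_pow, hf, ← map_pow, hf₀, map_zero]
    simp [Ad]

end Isometry

/-! ### The `sl₂`-property for isometry groups -/

section Main

variable {k ι : Type*} [Field k] [Fintype ι] [DecidableEq ι]

theorem isZariskiClosed_nilConePow (B : Matrix ι ι k) (r : ℕ) :
    IsZariskiClosed (nilConePow (skewAdjointMatricesLieSubalgebra B) r) := by
  let X : Matrix ι ι (MvPolynomial (ι × ι) k) := Matrix.mvPolynomialX ι ι k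
  let D : Matrix ι ι (MvPolynomial (ι × ι) k) := B.map MvPolynomial.C
  refine ⟨{q | ∃ i j, q = (Xᵀ * D + D * X) i j ∨ q = (X ^ r) i j}, ?_⟩
  ext x
  let E := MvPolynomial.eval fun ij : ι × ι => x ij.1 ij.2
  have hX : X.map E = x := Matrix.mvPolynomialX_mapMatrix_eval x
  have hD : D.map E = B := by ext i j; simp [D, E]
  have h1 : (Xᵀ * D + D * X).map E = xᵀ * B + B * x := by
    rw [Matrix.map_add _ (map_add E), Matrix.map_mul, Matrix.map_mul, Matrix.transpose_map, hX,
      hD]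
  have h2 : (X ^ r).map E = x ^ r := by
    have := map_pow E.mapMatrix X r
    rw [RingHom.mapMatrix_apply, RingHom.mapMatrix_apply, hX] at this
    exact this
  have hmem : x ∈ nilConePow (skewAdjointMatricesLieSubalgebra B) r ↔
      xᵀ * B + B * x = 0 ∧ x ^ r = 0 := by
    rw [← eq_neg_iff_add_eq_zero, ← mem_skewAdjoint_iff]
    exact ⟨fun h => ⟨h.1.1, h.2⟩, fun h => ⟨⟨h.1, r, h.2⟩, h.2⟩⟩
  rw [hmem, ← h1, ← h2]
  constructor
  · rintro ⟨ha, hb⟩ q ⟨i, j, rfl | rfl⟩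
    · exact congrFun₂ ha i j
    · exact congrFun₂ hb i j
  · intro h
    exact ⟨by ext i j; exact h _ ⟨i, j, Or.inl rfl⟩, by ext i j; exact h _ ⟨i, j, Or.inr rfl⟩⟩

theorem isStable_nilConePow {B : Matrix ι ι k} {G : Subgroup (GL ι k)}
    (hG : ∀ g, g ∈ G ↔ g.1ᵀ * B * g.1 = B) (r : ℕ) :
    IsStable G (nilConePow (skewAdjointMatricesLieSubalgebra B) r) := by
  rintro g hg x ⟨⟨hx, -⟩, hxr⟩
  have hxr' : Ad g x ^ r = 0 := by rw [Ad_pow, hxr]; simp [Ad]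
  refine ⟨⟨?_, r, hxr'⟩, hxr'⟩
  rw [mem_skewAdjoint_iff] at hx ⊢
  have h1 := (hG _).1 (G.inv_mem hg)
  have hgg : (g⁻¹).1 * g.1 = 1 := g.inv_mul
  rw [Ad]
  conv_lhs => rw [← h1]
  conv_rhs => rw [← h1]
  calc (g.1 * x * (g⁻¹).1)ᵀ * ((g⁻¹).1ᵀ * B * (g⁻¹).1)
      = (g⁻¹).1ᵀ * xᵀ * ((g⁻¹).1 * g.1)ᵀ * B * (g⁻¹).1 := by
        simp only [Matrix.transpose_mul, mul_assoc]
    _ = (g⁻¹).1ᵀ * (xᵀ * B) * (g⁻¹).1 := by rw [hgg]; simp [mul_assoc]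
    _ = -((g⁻¹).1ᵀ * B * ((g⁻¹).1 * g.1) * x * (g⁻¹).1) := by rw [hx, hgg]; simp [mul_assoc]
    _ = _ := by simp only [mul_assoc]

/-- The common form of both cases: `ε = 1` for orthogonal groups, `ε = -1` for symplectic groups. -/
theorem hasSl2Property_skewAdjoint [IsAlgClosed k] (p : ℕ) [CharP k p] (hp : 2 < p) {ε : k}
    (hε : ε * ε = 1) {B : Matrix ι ι k} (hB : B.det ≠ 0) (hBt : Bᵀ = ε • B)
    {G : Subgroup (GL ι k)} (hG : ∀ g, g ∈ G ↔ g.1ᵀ * B * g.1 = B) :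
    HasSl2Property G (skewAdjointMatricesLieSubalgebra B)
      (nilConePow (skewAdjointMatricesLieSubalgebra B) (p - 1)) := by
  have : Fact p.Prime := ⟨(CharP.char_is_prime_or_zero k p).resolve_right (by omega)⟩
  have h2 : (2 : k) ≠ 0 := by
    have := factorial_cast_ne_zero (k := k) p hp
    simpa using this
  refine ⟨fun x hx => hx.1, isZariskiClosed_nilConePow B _, isStable_nilConePow hG _, ?_, ?_⟩
  · intro s t
    refine Quotient.inductionOn₂ s t fun s t hst => ?_
    obtain ⟨g, -, hg⟩ := Quotient.exact hst
    obtain ⟨c, hce, hcf⟩ := exists_conj_of_Ad_eq p s.isTriple t.isTriple s.e_mem_V.2 s.f_mem_V.2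
      t.e_mem_V.2 t.f_mem_V.2 hg
    obtain ⟨u, hu, hconj⟩ := exists_isometry_of_conj h2 hε hB hBt c
    have he := hconj s.e t.e (mem_skewAdjoint_iff.1 s.e_mem) (mem_skewAdjoint_iff.1 t.e_mem) hce
    have hf := hconj s.f t.f (mem_skewAdjoint_iff.1 s.f_mem) (mem_skewAdjoint_iff.1 t.f_mem) hcf
    refine Quotient.sound ⟨u, (hG u).2 hu, he, ?_, hf⟩
    rw [← s.isTriple.lie_e_f, Ad_lie, he, hf, t.isTriple.lie_e_f]
  · intro x
    refine Quotient.inductionOn x fun x => ?_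
    obtain ⟨e, he⟩ := x
    have hskew := mem_skewAdjoint_iff.1 he.1.1
    obtain ⟨h, f, ht, hf, hfp⟩ := exists_isTriple_of_skew h2 hε hB hBt hskew he.2
    have hf := mem_skewAdjoint_iff.2 hf
    refine ⟨Quotient.mk _ ⟨e, h, f, he.1.1, ?_, hf, ht, he, ⟨hf, _, hfp⟩, hfp⟩, rfl⟩
    rw [← ht.lie_e_f]
    exact LieSubalgebra.lie_mem _ he.1.1 hf

theorem transpose_mul_mul_inv_eq {B : Matrix ι ι k} {g : GL ι k} (h : g.1ᵀ * B * g.1 = B) :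
    (g⁻¹).1ᵀ * B * (g⁻¹).1 = B := by
  have hgg : g.1 * (g⁻¹).1 = 1 := g.mul_inv
  calc (g⁻¹).1ᵀ * B * (g⁻¹).1 = (g⁻¹).1ᵀ * (g.1ᵀ * B * g.1) * (g⁻¹).1 := by rw [h]
    _ = (g.1 * (g⁻¹).1)ᵀ * B * (g.1 * (g⁻¹).1) := by simp only [Matrix.transpose_mul, mul_assoc]
    _ = B := by rw [hgg]; simp

theorem mem_symplecticGL_iff {m : ℕ} (g : GL (Fin m ⊕ Fin m) k) :
    g ∈ symplecticGL k m ↔ g.1ᵀ * Matrix.J (Fin m) k * g.1 = Matrix.J (Fin m) k := by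
  rw [symplecticGL, Submonoid.mem_units_iff, SymplecticGroup.mem_iff', SymplecticGroup.mem_iff']
  exact ⟨fun h => h.1, fun h => ⟨h, transpose_mul_mul_inv_eq h⟩⟩

theorem mem_orthogonalGL_iff {n : ℕ} (g : GL (Fin n) k) :
    g ∈ orthogonalGL k n ↔ g.1ᵀ * 1 * g.1 = 1 := by
  rw [orthogonalGL, Submonoid.mem_units_iff, Matrix.mem_orthogonalGroup_iff',
    Matrix.mem_orthogonalGroup_iff']
  refine ⟨fun h => by rw [mul_one, h.1], fun h => ⟨by rwa [mul_one] at h, ?_⟩⟩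
  simpa using transpose_mul_mul_inv_eq h

end Main

end Sl2Property

theorem proposition4p2 {k : Type*} [Field k] [IsAlgClosed k] (p : ℕ) [CharP k p] (hp : 2 < p) :
    (∀ m : ℕ,
      Sl2Property.HasSl2Property (Sl2Property.symplecticGL k m)
        (LieAlgebra.Symplectic.sp (Fin m) k)
        (Sl2Property.nilConePow (LieAlgebra.Symplectic.sp (Fin m) k) (p - 1))) ∧
    (∀ n : ℕ,
      Sl2Property.HasSl2Property (Sl2Property.orthogonalGL k n)
        (LieAlgebra.Orthogonal.so (Fin n) k)
        (Sl2Property.nilConePow (LieAlgebra.Orthogonal.so (Fin n) k) (p - 1))) := by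
  refine ⟨fun m => ?_, fun n => ?_⟩
  · exact Sl2Property.hasSl2Property_skewAdjoint p hp (ε := -1) (by simp)
      (Matrix.isUnit_det_J (Fin m) k).ne_zero (by rw [Matrix.J_transpose, neg_smul, one_smul])
      Sl2Property.mem_symplecticGL_iff
  · exact Sl2Property.hasSl2Property_skewAdjoint p hp (ε := 1) (by simp) (by simp) (by simp)
      Sl2Property.mem_orthogonalGL_iff
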